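/- For a real number $x\ge 2$, let $h_x$ be the multiplicative function supported on squarefree positive integers and defined on the primes $p$ by $h_x(p)=2\cos\!\left(\frac{\pi}{m+1}\right)$ if $x^{1/(m+1)}<p\le x^{1/m}$ for an integer $m\ge 1$, and $h_x(p)=0$ if $p>x$. Then there is an absolute constant $c_0>0$ such that, for all sufficiently large real $x$, $$\sum_{n\le x}h_x(n)\ \ge\ c_0\,x\log x .$$ -/

import Mathlib

namespace HeckeLowerBound

/-- The step function on `[0, 1]` with `α 0 = 2` and `α t = 2 cos (π / (m + 1))` for
`1 / (m + 1) < t ≤ 1 / m`, `m ≥ 1`; for such `t` the integer `m` is `⌊1 / t⌋`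
(see `alpha_eq`). Only its values on `[0, 1]` are used. -/
noncomputable def alpha (t : ℝ) : ℝ :=
  if t = 0 then 2 else 2 * Real.cos (Real.pi / ((⌊1 / t⌋₊ : ℝ) + 1))

/-- The values at primes: `α (log p / log x)` if `p ≤ x`, and `0` otherwise. -/
noncomputable def hPrime (x : ℝ) (p : ℕ) : ℝ :=
  if (p : ℝ) ≤ x then alpha (Real.log p / Real.log x) else 0

open Classical in
/-- The multiplicative function supported on squarefree numbers whose value at each prime `p`
is `hPrime x p`. -/
noncomputable def h (x : ℝ) : ArithmeticFunction ℝ where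
  toFun n := if Squarefree n then ∏ p ∈ n.primeFactors, hPrime x p else 0
  map_zero' := by simp

theorem alpha_eq {t : ℝ} {m : ℕ} (hm : 1 ≤ m) (h₁ : 1 / ((m : ℝ) + 1) < t)
    (h₂ : t ≤ 1 / (m : ℝ)) : alpha t = 2 * Real.cos (Real.pi / ((m : ℝ) + 1)) := by
  have hm' : (0 : ℝ) < m := by exact_mod_cast hm
  have ht : 0 < t := lt_trans (by positivity) h₁
  have hfl : ⌊1 / t⌋₊ = m := by
    rw [Nat.floor_eq_iff (by positivity)]
    constructor
    · rw [le_div_iff₀ ht]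
      rw [le_div_iff₀ hm'] at h₂
      linarith
    · rw [div_lt_iff₀ ht]
      rw [div_lt_iff₀ (by positivity)] at h₁
      linarith
  simp [alpha, ht.ne', ← hfl]

theorem h_apply_prime (x : ℝ) {p : ℕ} (hp : p.Prime) : h x p = hPrime x p := by
  simp [h, hp.squarefree, hp.primeFactors]

theorem h_apply_of_not_squarefree (x : ℝ) {n : ℕ} (hn : ¬ Squarefree n) : h x n = 0 := by
  simp [h, hn]

theorem h_isMultiplicative (x : ℝ) : (h x).IsMultiplicative := by
  refine ⟨by simp [h], fun {a b} hab => ?_⟩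
  by_cases ha : Squarefree a <;> by_cases hb : Squarefree b <;>
    simp [h, Nat.squarefree_mul hab, ha, hb, hab.primeFactors_mul,
      Finset.prod_union hab.disjoint_primeFactors]

end HeckeLowerBound

namespace HeckeLowerBound

/-! All values of `h x` are nonnegative, so it suffices to sum over a convenient family of `n`. On a
prime `p ≤ √x` the value is at least `1`, and it is near `2` when `log p / log x` is small; on
primes in `(√x, x]` it is `2 cos (π / 2) = 0`, so the large prime factors must stay below `√x`.

Put `z = x ^ (1/40)` and take `n = a p q r` with `a ≤ z ^ 2` squarefree and primes `p ∈ (z^10,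
z^11]`, `q ∈ (z^11, z^12]`, `r ∈ (z^12, x / (a p q)]`. The separated ranges make the factorization
unique. The product `p q` is large enough to force `r ≤ √x`; hence `h x n ≥ h x a ≥ 2 ^ ω(a) / 2`
(`two_pow_le_h`).

Chebyshev bounds give `≫ x / (a p q log x)` choices of `r` and `∑ 1/p, ∑ 1/q ≫ 1`. Since `∑ 2 ^ ω(a)
/ a ≫ (log z) ^ 2` (`log_sq_le_sum_squarefree`), the total is `≫ (x / log x) (log x) ^ 2`. -/

/-! ### Inequalities for finite sums and products -/

theorem sum_le_sum_of_injOn {ι κ : Type*} {s : Finset ι} {t : Finset κ} {f : ι → ℝ} {g : κ → ℝ}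
    (e : ι → κ) (he : Set.InjOn e s) (hst : ∀ i ∈ s, e i ∈ t) (hfg : ∀ i ∈ s, f i ≤ g (e i))
    (hg : ∀ j ∈ t, 0 ≤ g j) : ∑ i ∈ s, f i ≤ ∑ j ∈ t, g j := by
  classical
  calc ∑ i ∈ s, f i ≤ ∑ i ∈ s, g (e i) := Finset.sum_le_sum hfg
    _ = ∑ j ∈ s.image e, g j := (Finset.sum_image he).symm
    _ ≤ ∑ j ∈ t, g j := by
        refine Finset.sum_le_sum_of_subset_of_nonneg ?_ fun j hj _ => hg j hj
        intro j hj
        obtain ⟨i, hi, rfl⟩ := Finset.mem_image.1 hj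
        exact hst i hi

theorem one_sub_sum_le_prod_one_sub {ι : Type*} (s : Finset ι) (f : ι → ℝ)
    (h0 : ∀ i ∈ s, 0 ≤ f i) (h1 : ∀ i ∈ s, f i ≤ 1) :
    1 - ∑ i ∈ s, f i ≤ ∏ i ∈ s, (1 - f i) := by
  classical
  induction s using Finset.induction_on with
  | empty => simp
  | insert a s ha ih =>
    rw [Finset.sum_insert ha, Finset.prod_insert ha]
    have ih' := ih (fun i hi => h0 i (Finset.mem_insert_of_mem hi))
      (fun i hi => h1 i (Finset.mem_insert_of_mem hi))
    have a0 := h0 a (Finset.mem_insert_self _ _)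
    have a1 := h1 a (Finset.mem_insert_self _ _)
    have hs : 0 ≤ ∑ i ∈ s, f i :=
      Finset.sum_nonneg fun i hi => h0 i (Finset.mem_insert_of_mem hi)
    nlinarith [mul_le_mul_of_nonneg_left ih' (sub_nonneg.2 a1), mul_nonneg a0 hs]

/-! ### Sums over squarefree numbers -/

theorem sum_inv_sq_le_two (N : ℕ) : ∑ n ∈ Finset.Icc 1 N, ((n : ℝ) ^ 2)⁻¹ ≤ 2 := by
  have h := sum_Ioo_inv_sq_le (α := ℝ) 0 (N + 1)
  have e : Finset.Ioo 0 (N + 1) = Finset.Icc 1 N := by ext; simp; omega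
  rw [e] at h
  simpa using h

/-- Writing `n = b² a` with `a` squarefree bounds the harmonic sum by `(∑ 1/b²) (∑ 1/a)`, and the
first factor is at most `2`. -/
theorem log_le_two_mul_sum_squarefree_inv {z : ℝ} (hz : 0 ≤ z) :
    Real.log z ≤ 2 * ∑ n ∈ Finset.Icc 1 ⌊z⌋₊ with Squarefree n, (n : ℝ)⁻¹ := by
  have h1 : Real.log z ≤ ∑ n ∈ Finset.Icc 1 ⌊z⌋₊, (n : ℝ)⁻¹ := by
    refine (log_le_harmonic_floor z hz).trans_eq ?_
    rw [harmonic_eq_sum_Icc]; push_cast; rfl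
  set N := ⌊z⌋₊
  have h2 : ∑ n ∈ Finset.Icc 1 N, (n : ℝ)⁻¹ ≤
      ∑ q ∈ Finset.Icc 1 N ×ˢ (Finset.Icc 1 N).filter Squarefree,
        ((q.1 : ℝ) ^ 2)⁻¹ * (q.2 : ℝ)⁻¹ := by
    choose a b hab ha using Nat.sq_mul_squarefree
    refine sum_le_sum_of_injOn (fun n => (b n, a n)) ?_ ?_ ?_ fun _ _ => by positivity
    · intro m _ n _ h
      simp only [Prod.mk.injEq] at h
      rw [← hab m, ← hab n, h.1, h.2]
    · intro n hn
      have hn' := Finset.mem_Icc.1 hn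
      have hb0 : b n ≠ 0 := fun h => by have := hab n; simp [h] at this; omega
      have ha0 : a n ≠ 0 := (ha n).ne_zero
      have hdb : b n ∣ n := ⟨b n * a n, by rw [← mul_assoc, ← sq]; exact (hab n).symm⟩
      have hda : a n ∣ n := ⟨b n ^ 2, by rw [mul_comm]; exact (hab n).symm⟩
      have := Nat.le_of_dvd hn'.1 hdb
      have := Nat.le_of_dvd hn'.1 hda
      simp only [Finset.mem_product, Finset.mem_filter, Finset.mem_Icc]
      exact ⟨⟨by omega, by omega⟩, ⟨by omega, by omega⟩, ha n⟩
    · intro n _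
      conv_lhs => rw [← hab n]
      push_cast
      rw [mul_inv]
  simp only [Finset.sum_product] at h2
  rw [← Finset.sum_mul_sum] at h2
  refine h1.trans (h2.trans ?_)
  gcongr
  exact sum_inv_sq_le_two N

theorem card_divisors_of_squarefree {n : ℕ} (hn : Squarefree n) :
    n.divisors.card = 2 ^ n.primeFactors.card := by
  rw [Nat.card_divisors hn.ne_zero, ← Finset.prod_const]
  refine Finset.prod_congr rfl fun p hp => ?_
  have h1 := hn.natFactorization_le_one p
  have h2 := (Nat.prime_of_mem_primeFactors hp).factorization_pos_of_dvd hn.ne_zero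
    (Nat.dvd_of_mem_primeFactors hp)
  omega

/-- The pair `(d, f)` is encoded by `gcd d f`, `a = d f / (gcd d f)²` and the divisor
`d / gcd d f` of the squarefree number `a`. -/
theorem sq_sum_squarefree_inv_le (N : ℕ) :
    (∑ n ∈ Finset.Icc 1 N with Squarefree n, (n : ℝ)⁻¹) ^ 2 ≤
      2 * ∑ a ∈ Finset.Icc 1 (N ^ 2) with Squarefree a,
        (2 : ℝ) ^ a.primeFactors.card * (a : ℝ)⁻¹ := by
  set D := (Finset.Icc 1 N).filter Squarefree with hD
  set A := (Finset.Icc 1 (N ^ 2)).filter Squarefree with hA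
  have h2 : ∑ q ∈ D ×ˢ D, (q.1 : ℝ)⁻¹ * (q.2 : ℝ)⁻¹ ≤
      ∑ q ∈ Finset.Icc 1 N ×ˢ A.sigma (fun a => a.divisors),
        ((q.1 : ℝ) ^ 2)⁻¹ * (q.2.1 : ℝ)⁻¹ := by
    refine sum_le_sum_of_injOn (fun q => (Nat.gcd q.1 q.2,
      ⟨(q.1 / Nat.gcd q.1 q.2) * (q.2 / Nat.gcd q.1 q.2), q.1 / Nat.gcd q.1 q.2⟩)) ?_ ?_ ?_
      fun _ _ => by positivity
    · rintro ⟨d, f⟩ h ⟨d', f'⟩ _ heq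
      simp only [Prod.mk.injEq, Sigma.mk.injEq, heq_eq_eq] at heq
      obtain ⟨hg, hm, hd⟩ := heq
      simp only [Finset.coe_product, Set.mem_prod, Finset.mem_coe, hD, Finset.mem_filter,
        Finset.mem_Icc] at h
      have hpos : 0 < d / Nat.gcd d f :=
        Nat.div_pos (Nat.gcd_le_left _ (by omega)) (Nat.gcd_pos_of_pos_left _ (by omega))
      have hf : f / Nat.gcd d f = f' / Nat.gcd d' f' := by
        rw [← hd] at hm
        exact Nat.eq_of_mul_eq_mul_left hpos hm
      have e1 := Nat.div_mul_cancel (Nat.gcd_dvd_left d f)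
      have e2 := Nat.div_mul_cancel (Nat.gcd_dvd_right d f)
      have e3 := Nat.div_mul_cancel (Nat.gcd_dvd_left d' f')
      have e4 := Nat.div_mul_cancel (Nat.gcd_dvd_right d' f')
      rw [Prod.mk.injEq]
      constructor
      · rw [← e1, ← e3, hd, hg]
      · rw [← e2, ← e4, hf, hg]
    · rintro ⟨d, f⟩ h
      simp only [hD, Finset.mem_product, Finset.mem_filter, Finset.mem_Icc] at h
      obtain ⟨⟨⟨hd1, hdN⟩, hds⟩, ⟨hf1, hfN⟩, hfs⟩ := h
      have hg : 0 < Nat.gcd d f := Nat.gcd_pos_of_pos_left _ (by omega)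
      have hd' : 0 < d / Nat.gcd d f := Nat.div_pos (Nat.gcd_le_left _ (by omega)) hg
      have hf' : 0 < f / Nat.gcd d f := Nat.div_pos (Nat.gcd_le_right _ (by omega)) hg
      have hdN' : d / Nat.gcd d f ≤ N := (Nat.div_le_self _ _).trans hdN
      have hfN' : f / Nat.gcd d f ≤ N := (Nat.div_le_self _ _).trans hfN
      have hco : Nat.Coprime (d / Nat.gcd d f) (f / Nat.gcd d f) := Nat.coprime_div_gcd_div_gcd hg
      have hsq : Squarefree (d / Nat.gcd d f * (f / Nat.gcd d f)) :=
        (Nat.squarefree_mul hco).2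
          ⟨hds.squarefree_of_dvd (Nat.div_dvd_of_dvd (Nat.gcd_dvd_left _ _)),
            hfs.squarefree_of_dvd (Nat.div_dvd_of_dvd (Nat.gcd_dvd_right _ _))⟩
      simp only [hA, Finset.mem_product, Finset.mem_sigma, Finset.mem_filter, Finset.mem_Icc,
        Nat.mem_divisors]
      refine ⟨⟨hg, (Nat.gcd_le_left _ (by omega)).trans hdN⟩, ⟨⟨Nat.mul_pos hd' hf', ?_⟩, hsq⟩,
        Dvd.intro _ rfl, hsq.ne_zero⟩
      rw [sq]
      exact Nat.mul_le_mul hdN' hfN'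
    · rintro ⟨d, f⟩ _
      have e1 : ((d / Nat.gcd d f : ℕ) : ℝ) * (Nat.gcd d f : ℝ) = d := by
        exact_mod_cast Nat.div_mul_cancel (Nat.gcd_dvd_left d f)
      have e2 : ((f / Nat.gcd d f : ℕ) : ℝ) * (Nat.gcd d f : ℝ) = f := by
        exact_mod_cast Nat.div_mul_cancel (Nat.gcd_dvd_right d f)
      refine le_of_eq ?_
      dsimp only
      conv_lhs => rw [← e1, ← e2]
      push_cast
      rw [← mul_inv, ← mul_inv]
      congr 1
      ring
  simp only [Finset.sum_product] at h2
  rw [← Finset.sum_mul_sum, ← sq,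
    ← Finset.sum_mul_sum (Finset.Icc 1 N) (A.sigma fun a => a.divisors)
      (fun g => ((g : ℝ) ^ 2)⁻¹) (fun q => (q.1 : ℝ)⁻¹), Finset.sum_sigma] at h2
  refine h2.trans ?_
  -- The weight does not depend on the divisor `d`, so the inner sum counts the `2 ^ ω(a)` divisors
  -- of `a`.
  have e : ∑ a ∈ A, ∑ _d ∈ a.divisors, (a : ℝ)⁻¹ =
      ∑ a ∈ A, (2 : ℝ) ^ a.primeFactors.card * (a : ℝ)⁻¹ := by
    refine Finset.sum_congr rfl fun a ha => ?_
    rw [Finset.sum_const, card_divisors_of_squarefree (Finset.mem_filter.1 ha).2, nsmul_eq_mul]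
    push_cast; rfl
  rw [e]
  exact mul_le_mul_of_nonneg_right (sum_inv_sq_le_two N)
    (Finset.sum_nonneg fun _ _ => by positivity)

theorem log_sq_le_sum_squarefree {z : ℝ} (hz : 1 ≤ z) :
    Real.log z ^ 2 ≤ 8 * ∑ a ∈ Finset.Icc 1 (⌊z⌋₊ ^ 2) with Squarefree a,
        (2 : ℝ) ^ a.primeFactors.card * (a : ℝ)⁻¹ := by
  have h1 := log_le_two_mul_sum_squarefree_inv (zero_le_one.trans hz)
  have h2 := sq_sum_squarefree_inv_le ⌊z⌋₊
  have h3 := pow_le_pow_left₀ (Real.log_nonneg hz) h1 2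
  rw [mul_pow] at h3
  linarith

/-! ### Values of `h` -/

theorem hPrime_eq {x : ℝ} {p : ℕ} (hp : p.Prime) (hpx : (p : ℝ) ≤ x) :
    hPrime x p = 2 * Real.cos (Real.pi / ((⌊Real.log x / Real.log p⌋₊ : ℝ) + 1)) := by
  have h2 : (1 : ℝ) < p := by exact_mod_cast hp.one_lt
  have hlp : 0 < Real.log p := Real.log_pos h2
  have hlx : 0 < Real.log x := Real.log_pos (h2.trans_le hpx)
  rw [hPrime, if_pos hpx, alpha, if_neg (div_pos hlp hlx).ne', one_div_div]

theorem hPrime_nonneg (x : ℝ) {p : ℕ} (hp : p.Prime) : 0 ≤ hPrime x p := by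
  by_cases hpx : (p : ℝ) ≤ x
  · have h2 : (1 : ℝ) < p := by exact_mod_cast hp.one_lt
    have hlp : 0 < Real.log p := Real.log_pos h2
    have hm : 1 ≤ ⌊Real.log x / Real.log p⌋₊ := by
      rw [Nat.le_floor_iff' one_ne_zero, Nat.cast_one, one_le_div hlp]
      exact Real.log_le_log (by linarith) hpx
    have hm' : (1 : ℝ) ≤ ⌊Real.log x / Real.log p⌋₊ := by exact_mod_cast hm
    rw [hPrime_eq hp hpx]
    refine mul_nonneg zero_le_two (Real.cos_nonneg_of_mem_Icc ⟨?_, ?_⟩)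
    · have : 0 ≤ Real.pi / ((⌊Real.log x / Real.log p⌋₊ : ℝ) + 1) := by positivity
      linarith [Real.pi_pos]
    · exact div_le_div_of_nonneg_left Real.pi_pos.le two_pos (by linarith)
  · rw [hPrime, if_neg hpx]

/-- Here `m ≥ 2`, so the angle `π / (m + 1)` is at most `π / 3`, whose cosine is `1 / 2`. -/
theorem one_le_hPrime {x : ℝ} {p : ℕ} (hp : p.Prime) (hpx : (p : ℝ) ^ 2 ≤ x) :
    1 ≤ hPrime x p := by
  have h2 : (1 : ℝ) < p := by exact_mod_cast hp.one_lt
  have hlp : 0 < Real.log p := Real.log_pos h2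
  have hm : 2 ≤ ⌊Real.log x / Real.log p⌋₊ := by
    rw [Nat.le_floor_iff' two_ne_zero, le_div_iff₀ hlp]
    have := Real.log_le_log (by positivity) hpx
    rwa [Real.log_pow] at this
  have hm' : (2 : ℝ) ≤ ⌊Real.log x / Real.log p⌋₊ := by exact_mod_cast hm
  rw [hPrime_eq hp (by nlinarith)]
  have : Real.cos (Real.pi / 3) ≤
      Real.cos (Real.pi / ((⌊Real.log x / Real.log p⌋₊ : ℝ) + 1)) := by
    refine Real.cos_le_cos_of_nonneg_of_le_pi (by positivity) (by linarith [Real.pi_pos]) ?_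
    exact div_le_div_of_nonneg_left Real.pi_pos.le (by norm_num) (by linarith)
  rw [Real.cos_pi_div_three] at this
  linarith

/-- With `u = log p / log x`, one has `m + 1 > 1 / u`, so the angle is at most `π u ≤ 4 u`; then
`cos t ≥ 1 - t² / 2 ≥ 1 - 8 u²`. -/
theorem two_mul_le_hPrime {x : ℝ} {p : ℕ} (hp : p.Prime) (hpx : (p : ℝ) ≤ x) :
    2 * (1 - 8 * (Real.log p / Real.log x) ^ 2) ≤ hPrime x p := by
  have h2 : (1 : ℝ) < p := by exact_mod_cast hp.one_lt
  have hlp : 0 < Real.log p := Real.log_pos h2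
  have hlx : 0 < Real.log x := Real.log_pos (h2.trans_le hpx)
  rw [hPrime_eq hp hpx]
  set t := Real.pi / ((⌊Real.log x / Real.log p⌋₊ : ℝ) + 1) with ht
  have ht0 : 0 ≤ t := by positivity
  have ht1 : t ≤ 4 * (Real.log p / Real.log x) := by
    have hfl := Nat.lt_floor_add_one (Real.log x / Real.log p)
    have hq : 0 < Real.log x / Real.log p := div_pos hlx hlp
    calc t ≤ 4 / (Real.log x / Real.log p) :=
          div_le_div₀ (by norm_num) Real.pi_le_four hq hfl.le
      _ = 4 * (Real.log p / Real.log x) := by rw [div_eq_mul_inv, inv_div]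
  have hcos := Real.one_sub_sq_div_two_le_cos (x := t)
  nlinarith [pow_le_pow_left₀ ht0 ht1 2]

theorem h_nonneg (x : ℝ) (n : ℕ) : 0 ≤ h x n := by
  by_cases hn : Squarefree n
  · simp only [h, ArithmeticFunction.coe_mk, if_pos hn]
    exact Finset.prod_nonneg fun p hp => hPrime_nonneg x (Nat.prime_of_mem_primeFactors hp)
  · rw [h_apply_of_not_squarefree x hn]

theorem sum_log_primeFactors_of_squarefree {n : ℕ} (hn : Squarefree n) :
    ∑ p ∈ n.primeFactors, Real.log p = Real.log n := by
  conv_rhs => rw [← Nat.prod_primeFactors_of_squarefree hn]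
  rw [Nat.cast_prod, Real.log_prod]
  intro p hp
  exact_mod_cast (Nat.prime_of_mem_primeFactors hp).ne_zero

/-- Since `∑ (log p / log x)² ≤ 1 / 16` over the primes `p ∣ a`, the values of `h x` are of the
order of the divisor function on squarefree `a` up to a small power of `x`. -/
theorem two_pow_le_h {x : ℝ} {a : ℕ} (ha : Squarefree a) (hax : (a : ℝ) ^ 4 ≤ x) (hx : 1 < x) :
    2 ^ a.primeFactors.card / 2 ≤ h x a := by
  have ha1 : (1 : ℝ) ≤ a := by exact_mod_cast Nat.one_le_iff_ne_zero.2 ha.ne_zero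
  have hlx : 0 < Real.log x := Real.log_pos hx
  have hla : 0 ≤ Real.log a := Real.log_nonneg ha1
  have hlog : 4 * Real.log a ≤ Real.log x := by
    have := Real.log_le_log (by positivity) hax
    rwa [Real.log_pow] at this
  have hax' : (a : ℝ) ≤ x := (le_self_pow₀ ha1 (by norm_num)).trans hax
  have hratio : Real.log a / Real.log x ≤ 1 / 4 := by rw [div_le_iff₀ hlx]; linarith
  have hfac : ∀ p ∈ a.primeFactors, 0 ≤ Real.log p ∧ Real.log p ≤ Real.log a := by
    intro p hp
    have hp' := Nat.prime_of_mem_primeFactors hp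
    exact ⟨Real.log_natCast_nonneg p, Real.log_le_log (by exact_mod_cast hp'.pos)
      (by exact_mod_cast Nat.le_of_mem_primeFactors hp)⟩
  have hu : ∀ p ∈ a.primeFactors, 8 * (Real.log p / Real.log x) ^ 2 ≤ 1 := by
    intro p hp
    obtain ⟨h0, h1⟩ := hfac p hp
    have h2 : Real.log p / Real.log x ≤ 1 / 4 := by rw [div_le_iff₀ hlx]; linarith
    have h3 : 0 ≤ Real.log p / Real.log x := by positivity
    nlinarith
  -- Each ratio `u = log p / log x` is at most `1/4`, so `8 u² ≤ 2 u`; the ratios add up to `log a /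
  -- log x ≤ 1/4`.
  have hsum : ∑ p ∈ a.primeFactors, 8 * (Real.log p / Real.log x) ^ 2 ≤ 1 / 2 := by
    have h1 : ∀ p ∈ a.primeFactors, 8 * (Real.log p / Real.log x) ^ 2 ≤
        2 * (Real.log p / Real.log x) := by
      intro p hp
      obtain ⟨h0, h1⟩ := hfac p hp
      have h2 : Real.log p / Real.log x ≤ 1 / 4 := by rw [div_le_iff₀ hlx]; linarith
      have h3 : 0 ≤ Real.log p / Real.log x := by positivity
      nlinarith
    refine (Finset.sum_le_sum h1).trans ?_
    rw [← Finset.mul_sum, ← Finset.sum_div, sum_log_primeFactors_of_squarefree ha]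
    linarith
  simp only [h, ArithmeticFunction.coe_mk, if_pos ha]
  calc (2 : ℝ) ^ a.primeFactors.card / 2
      ≤ 2 ^ a.primeFactors.card *
          ∏ p ∈ a.primeFactors, (1 - 8 * (Real.log p / Real.log x) ^ 2) := by
        rw [div_eq_mul_inv]
        gcongr
        have := one_sub_sum_le_prod_one_sub a.primeFactors
          (fun p => 8 * (Real.log p / Real.log x) ^ 2) (fun p _ => by positivity) hu
        linarith
    _ = ∏ p ∈ a.primeFactors, 2 * (1 - 8 * (Real.log p / Real.log x) ^ 2) := by
        rw [Finset.prod_mul_distrib, Finset.prod_const]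
    _ ≤ ∏ p ∈ a.primeFactors, hPrime x p := by
        refine Finset.prod_le_prod (fun p hp => by linarith [hu p hp]) fun p hp => ?_
        refine two_mul_le_hPrime (Nat.prime_of_mem_primeFactors hp) (le_trans ?_ hax')
        exact_mod_cast Nat.le_of_mem_primeFactors hp

/-! ### Primes in intervals -/

/-- The primes in the interval `(y, w]`. -/
noncomputable def primesIoc (y w : ℝ) : Finset ℕ := (Finset.Ioc ⌊y⌋₊ ⌊w⌋₊).filter Nat.Prime

theorem mem_primesIoc {y w : ℝ} (hy : 0 ≤ y) (hw : 0 ≤ w) {p : ℕ} :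
    p ∈ primesIoc y w ↔ (y < p ∧ (p : ℝ) ≤ w) ∧ p.Prime := by
  rw [primesIoc, Finset.mem_filter, Finset.mem_Ioc, Nat.floor_lt hy, Nat.le_floor_iff hw]

theorem sum_log_primesIoc {y w : ℝ} (hyw : y ≤ w) :
    ∑ p ∈ primesIoc y w, Real.log p = Chebyshev.theta w - Chebyshev.theta y := by
  have hd : Disjoint ((Finset.Ioc 0 ⌊y⌋₊).filter Nat.Prime) (primesIoc y w) := by
    rw [Finset.disjoint_left]
    intro p hp hq
    have h1 := (Finset.mem_Ioc.1 (Finset.mem_filter.1 hp).1).2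
    have h2 := (Finset.mem_Ioc.1 (Finset.mem_filter.1 hq).1).1
    omega
  have hu : (Finset.Ioc 0 ⌊w⌋₊).filter Nat.Prime =
      (Finset.Ioc 0 ⌊y⌋₊).filter Nat.Prime ∪ primesIoc y w := by
    rw [primesIoc, ← Finset.filter_union,
      Finset.Ioc_union_Ioc_eq_Ioc (Nat.zero_le _) (Nat.floor_le_floor hyw)]
  rw [Chebyshev.theta, Chebyshev.theta, hu, Finset.sum_union hd]
  ring

theorem theta_le {y : ℝ} (hy : 0 ≤ y) : Chebyshev.theta y ≤ 3 / 2 * y := by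
  refine (Chebyshev.theta_le_log4_mul_x hy).trans ?_
  have : Real.log 4 = 2 * Real.log 2 := by
    rw [show (4 : ℝ) = 2 ^ 2 by norm_num, Real.log_pow]; norm_num
  have := Real.log_two_lt_d9
  gcongr
  linarith

theorem eventually_half_le_theta : ∀ᶠ y : ℝ in Filter.atTop, y / 2 ≤ Chebyshev.theta y := by
  have h1 : ∀ᶠ y : ℝ in Filter.atTop, Real.log y ≤ 1 / 100 * y ^ (1 / 2 : ℝ) := by
    have := (isLittleO_log_rpow_atTop (r := 1 / 2) (by norm_num)).def (c := 1 / 100) (by norm_num)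
    filter_upwards [this, Filter.eventually_ge_atTop 1] with y hy hy1
    rwa [Real.norm_of_nonneg (Real.log_nonneg hy1), Real.norm_of_nonneg (by positivity)] at hy
  filter_upwards [h1, Filter.eventually_ge_atTop 10000] with y hy hy1
  rw [← Real.sqrt_eq_rpow] at hy
  have hs : √y * √y = y := Real.mul_self_sqrt (by linarith)
  have hs0 : 100 ≤ √y := Real.le_sqrt_of_sq_le (by linarith)
  have h2 : Real.log (y + 2) ≤ 1 + Real.log y := by
    have hle : Real.log (y + 2) ≤ Real.log (2 * y) := Real.log_le_log (by linarith) (by linarith)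
    rw [Real.log_mul two_ne_zero (by linarith)] at hle
    linarith [Real.log_two_lt_d9]
  have h3 := Chebyshev.theta_ge' (x := y) (by linarith)
  have h4 := Real.log_two_gt_d9
  -- The main term is about `0.69 y`; the errors `2 √y log y` and `log (y + 2)` fit into the surplus
  -- over `y / 2`.
  have h5 : 2 * √y * Real.log y ≤ y / 50 := by nlinarith
  have h6 : (y - 1) * 0.69 ≤ (y - 1) * Real.log 2 := by gcongr; linarith; linarith
  nlinarith

/-- Each block `(w, 4w]` contributes at least `1/8`: `θ(4w) - θ(w) ≥ 2w - 3w/2 = w/2`, and each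
`1/p` is at least `1/(4w)`. The ratio `4` makes `θ(4w)` beat the upper bound for `θ(w)`. -/
theorem exists_sum_log_div_primesIoc_pow_ge : ∃ Y : ℝ, 1 ≤ Y ∧ ∀ y : ℝ, Y ≤ y → ∀ K : ℕ,
    (K : ℝ) / 8 ≤ ∑ p ∈ primesIoc y (4 ^ K * y), Real.log p / p := by
  obtain ⟨Y, hY⟩ := Filter.eventually_atTop.1 eventually_half_le_theta
  refine ⟨max Y 1, le_max_right _ _, fun y hy K => ?_⟩
  have hy1 : 1 ≤ y := (le_max_right _ _).trans hy
  induction K with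
  | zero =>
    rw [Nat.cast_zero, zero_div]
    exact Finset.sum_nonneg fun p _ => div_nonneg (Real.log_natCast_nonneg p) p.cast_nonneg
  | succ K ih =>
    set w := 4 ^ K * y with hw
    have hyw : y ≤ w := le_mul_of_one_le_left (by linarith) (one_le_pow₀ (by norm_num))
    have hw4 : (4 : ℝ) ^ (K + 1) * y = 4 * w := by rw [hw]; ring
    have hd : Disjoint (primesIoc y w) (primesIoc w (4 * w)) := by
      rw [Finset.disjoint_left]
      intro p hp hq
      rw [mem_primesIoc (by linarith) (by linarith)] at hp hq
      linarith [hp.1.2, hq.1.1]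
    have hu : primesIoc y (4 * w) = primesIoc y w ∪ primesIoc w (4 * w) := by
      rw [primesIoc, primesIoc, primesIoc, ← Finset.filter_union,
        Finset.Ioc_union_Ioc_eq_Ioc (Nat.floor_le_floor hyw) (Nat.floor_le_floor (by linarith))]
    rw [hw4, hu, Finset.sum_union hd]
    have hblock : 1 / 8 ≤ ∑ p ∈ primesIoc w (4 * w), Real.log p / p := by
      have h1 : ∑ p ∈ primesIoc w (4 * w), Real.log p / (4 * w) ≤
          ∑ p ∈ primesIoc w (4 * w), Real.log p / p := by
        refine Finset.sum_le_sum fun p hp => ?_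
        rw [mem_primesIoc (by linarith) (by linarith)] at hp
        exact div_le_div_of_nonneg_left (Real.log_natCast_nonneg p)
          (by exact_mod_cast hp.2.pos) hp.1.2
      refine le_trans ?_ h1
      rw [← Finset.sum_div, sum_log_primesIoc (by linarith), le_div_iff₀ (by linarith)]
      have := hY (4 * w) (by linarith [(le_max_left Y 1).trans hy])
      have := theta_le (y := w) (by linarith)
      linarith
    push_cast
    linarith

theorem exists_sum_log_div_primesIoc_ge : ∃ Z : ℝ, 1 ≤ Z ∧ ∀ z y : ℝ, Z ≤ z → z ≤ y →
    Real.log z / 32 ≤ ∑ p ∈ primesIoc y (z * y), Real.log p / p := by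
  obtain ⟨Y, hY1, hY⟩ := exists_sum_log_div_primesIoc_pow_ge
  refine ⟨max Y 16, hY1.trans (le_max_left _ _), fun z y hz hy => ?_⟩
  have hz16 : 16 ≤ z := (le_max_right _ _).trans hz
  have hzY : Y ≤ z := (le_max_left _ _).trans hz
  set K := ⌊Real.log z / Real.log 4⌋₊
  have hl4 : 0 < Real.log 4 := Real.log_pos (by norm_num)
  have hl4' : Real.log 4 = 2 * Real.log 2 := by
    rw [show (4 : ℝ) = 2 ^ 2 by norm_num, Real.log_pow]; norm_num
  have hl2 := Real.log_two_lt_d9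
  have hlz : 2 * Real.log 4 ≤ Real.log z := by
    have := Real.log_le_log (by norm_num) hz16
    rw [show (16 : ℝ) = 4 ^ 2 by norm_num, Real.log_pow] at this
    exact_mod_cast this
  have hK : (4 : ℝ) ^ K ≤ z := by
    rw [← Real.log_le_log_iff (by positivity) (by linarith), Real.log_pow]
    have := Nat.floor_le (a := Real.log z / Real.log 4)
      (div_nonneg (by linarith) hl4.le)
    rwa [le_div_iff₀ hl4] at this
  -- As `z ≥ 16`, rounding down loses at most half of `log z / log 4`; then `log 4 ≤ 2`.
  have hK' : Real.log z / 4 ≤ K := by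
    have h1 := Nat.lt_floor_add_one (Real.log z / Real.log 4)
    have h2 : Real.log z / 2 / Real.log 4 + 1 ≤ Real.log z / Real.log 4 := by
      rw [div_add_one hl4.ne']
      gcongr
      linarith
    have h3 : Real.log z / 4 ≤ Real.log z / 2 / Real.log 4 := by
      rw [le_div_iff₀ hl4]
      nlinarith
    linarith
  calc Real.log z / 32 ≤ (K : ℝ) / 8 := by linarith
    _ ≤ ∑ p ∈ primesIoc y (4 ^ K * y), Real.log p / p := hY y (hzY.trans hy) K
    _ ≤ ∑ p ∈ primesIoc y (z * y), Real.log p / p := by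
        refine Finset.sum_le_sum_of_subset_of_nonneg ?_ fun p _ _ =>
          div_nonneg (Real.log_natCast_nonneg p) p.cast_nonneg
        refine Finset.filter_subset_filter _ (Finset.Ioc_subset_Ioc_right ?_)
        exact Nat.floor_le_floor (by gcongr; linarith)

theorem sum_inv_primesIoc_ge {z y x : ℝ} (hz : 1 < z) (hy : 0 ≤ y) (hx : 1 < x) (hyx : z * y ≤ x)
    (h : Real.log z / 32 ≤ ∑ p ∈ primesIoc y (z * y), Real.log p / p) :
    Real.log z / (32 * Real.log x) ≤ ∑ p ∈ primesIoc y (z * y), (p : ℝ)⁻¹ := by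
  have hlx := Real.log_pos hx
  rw [← div_div, div_le_iff₀ hlx, Finset.sum_mul]
  refine h.trans (Finset.sum_le_sum fun p hp => ?_)
  rw [mem_primesIoc hy (by positivity)] at hp
  have hp0 : (0 : ℝ) < p := by exact_mod_cast hp.2.pos
  rw [div_eq_inv_mul]
  gcongr
  exact hp.1.2.trans hyx

/-- `θ(y) - θ(w) ≥ y/2 - 3w/2 ≥ y/4` when `6w ≤ y`, and each prime counted contributes at most `log
x`. -/
theorem exists_card_primesIoc_ge : ∃ Y : ℝ, 1 ≤ Y ∧ ∀ w y x : ℝ, Y ≤ y → 0 ≤ w → 6 * w ≤ y →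
    y ≤ x → 1 < x → y / (4 * Real.log x) ≤ (primesIoc w y).card := by
  obtain ⟨Y, hY⟩ := Filter.eventually_atTop.1 eventually_half_le_theta
  refine ⟨max Y 1, le_max_right _ _, fun w y x hy hw hwy hyx hx => ?_⟩
  have hlx := Real.log_pos hx
  have h1 := hY y ((le_max_left _ _).trans hy)
  have h2 := theta_le hw
  have h3 : ∑ p ∈ primesIoc w y, Real.log p ≤ ∑ _p ∈ primesIoc w y, Real.log x := by
    refine Finset.sum_le_sum fun p hp => ?_
    rw [mem_primesIoc hw (by linarith)] at hp
    exact Real.log_le_log (by exact_mod_cast hp.2.pos) (hp.1.2.trans hyx)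
  rw [sum_log_primesIoc (by linarith), Finset.sum_const, nsmul_eq_mul] at h3
  rw [← div_div, div_le_iff₀ hlx]
  linarith

/-! ### The lower bound -/

theorem h_mul_prime {x : ℝ} {n p : ℕ} (hp : p.Prime) (hpx : (p : ℝ) ^ 2 ≤ x) (hpn : ¬ p ∣ n) :
    h x n ≤ h x (n * p) := by
  have hco : Nat.Coprime n p := ((Nat.Prime.coprime_iff_not_dvd hp).2 hpn).symm
  rw [(h_isMultiplicative x).map_mul_of_coprime hco, h_apply_prime x hp]
  exact le_mul_of_one_le_right (h_nonneg x n) (one_le_hPrime hp hpx)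

/-- Restriction of the sum to products `a p q r` of a small number `a` and primes
`p`, `q`, `r` in consecutive intervals. -/
theorem sum_h_ge {x y₁ y₂ y₃ : ℝ} {A : Finset ℕ} (hA : ∀ a ∈ A, 0 < a ∧ (a : ℝ) ≤ y₁)
    (h0 : 0 ≤ y₁) (h12 : y₁ ≤ y₂) (h23 : y₂ ≤ y₃) (h3x : y₃ ^ 2 ≤ x)
    (hlarge : ∀ a ∈ A, ∀ p ∈ primesIoc y₁ y₂, ∀ q ∈ primesIoc y₂ y₃,
      (x / (a * p * q)) ^ 2 ≤ x) :
    ∑ a ∈ A, ∑ p ∈ primesIoc y₁ y₂, ∑ q ∈ primesIoc y₂ y₃,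
      h x a * (primesIoc y₃ (x / (a * p * q))).card ≤ ∑ n ∈ Finset.Icc 1 ⌊x⌋₊, h x n := by
  have hx0 : 0 ≤ x := (sq_nonneg _).trans h3x
  have hy2 : 0 ≤ y₂ := h0.trans h12
  have hy3 : 0 ≤ y₃ := hy2.trans h23
  have hprod : ∀ a p q r : ℕ, a ∈ A → p ∈ primesIoc y₁ y₂ → q ∈ primesIoc y₂ y₃ →
      r ∈ primesIoc y₃ (x / (a * p * q)) → 0 < a ∧ p.Prime ∧ q.Prime ∧ r.Prime ∧ a < p ∧
        p < q ∧ q < r ∧ (p : ℝ) ≤ y₂ ∧ y₂ < q ∧ (q : ℝ) ≤ y₃ ∧ y₃ < r ∧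
        ((r : ℝ) ≤ x / (a * p * q)) ∧ y₁ < p ∧ (a : ℝ) ≤ y₁ := by
    intro a p q r ha hp hq hr
    rw [mem_primesIoc h0 hy2] at hp
    rw [mem_primesIoc hy2 hy3] at hq
    rw [mem_primesIoc hy3 (by positivity)] at hr
    refine ⟨(hA a ha).1, hp.2, hq.2, hr.2, ?_, ?_, ?_, hp.1.2, hq.1.1, hq.1.2, hr.1.1, hr.1.2,
      hp.1.1, (hA a ha).2⟩
    · exact_mod_cast (hA a ha).2.trans_lt hp.1.1
    · exact_mod_cast hp.1.2.trans_lt hq.1.1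
    · exact_mod_cast hq.1.2.trans_lt hr.1.1
  set T : Finset (Σ _ : ℕ, Σ _ : ℕ, Σ _ : ℕ, ℕ) := A.sigma fun a => (primesIoc y₁ y₂).sigma fun p =>
    (primesIoc y₂ y₃).sigma fun q => primesIoc y₃ (x / (a * p * q)) with hT
  have hmem : ∀ t ∈ T, t.1 ∈ A ∧ t.2.1 ∈ primesIoc y₁ y₂ ∧ t.2.2.1 ∈ primesIoc y₂ y₃ ∧
      t.2.2.2 ∈ primesIoc y₃ (x / (t.1 * t.2.1 * t.2.2.1)) := by
    intro t ht
    simpa only [hT, Finset.mem_sigma] using ht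
  have hsum : ∑ a ∈ A, ∑ p ∈ primesIoc y₁ y₂, ∑ q ∈ primesIoc y₂ y₃,
      h x a * (primesIoc y₃ (x / (a * p * q))).card = ∑ t ∈ T, h x t.1 := by
    simp only [hT, Finset.sum_sigma]
    simp only [Finset.sum_const, nsmul_eq_mul, mul_comm (h x _)]
  rw [hsum]
  refine sum_le_sum_of_injOn (fun t => t.1 * t.2.1 * t.2.2.1 * t.2.2.2) ?_ ?_ ?_
    fun n _ => h_nonneg x n
  · rintro ⟨a, p, q, r⟩ ht ⟨a', p', q', r'⟩ ht' heq
    obtain ⟨m1, m2, m3, m4⟩ := hmem _ ht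
    obtain ⟨m1', m2', m3', m4'⟩ := hmem _ ht'
    obtain ⟨ha, hp, hq, hr, hap, hpq, hqr, hp2, hq2, hq3, hr3, -, hp1, ha1⟩ :=
      hprod a p q r m1 m2 m3 m4
    obtain ⟨ha', hp', hq', hr', hap', hpq', hqr', hp2', hq2', hq3', hr3', -, hp1', ha1'⟩ :=
      hprod a' p' q' r' m1' m2' m3' m4'
    dsimp only at heq
    have hpq'' : p < q' := by exact_mod_cast hp2.trans_lt hq2'
    have hqr'' : q < r' := by exact_mod_cast hq3.trans_lt hr3'
    have hp'q : p' < q := by exact_mod_cast hp2'.trans_lt hq2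
    have hq'r : q' < r := by exact_mod_cast hq3'.trans_lt hr3
    have ha'p : a' < p := by exact_mod_cast ha1'.trans_lt hp1
    -- A prime exceeding `a'` cannot divide `a'`, so it is one of `p'`, `q'`, `r'`; the disjoint
    -- ranges then decide which.
    have key : ∀ s : ℕ, s.Prime → a' < s → s ∣ a * p * q * r → s = p' ∨ s = q' ∨ s = r' := by
      intro s hs has hdvd
      rw [heq, hs.dvd_mul, hs.dvd_mul, hs.dvd_mul] at hdvd
      rcases hdvd with ((hd | hd) | hd) | hd
      · exact absurd (Nat.le_of_dvd ha' hd) (by omega)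
      · exact Or.inl ((Nat.prime_dvd_prime_iff_eq hs hp').1 hd)
      · exact Or.inr (Or.inl ((Nat.prime_dvd_prime_iff_eq hs hq').1 hd))
      · exact Or.inr (Or.inr ((Nat.prime_dvd_prime_iff_eq hs hr').1 hd))
    have kp := key p hp ha'p ⟨a * q * r, by ring⟩
    have kq := key q hq (by omega) ⟨a * p * r, by ring⟩
    have kr := key r hr (by omega) ⟨a * p * q, by ring⟩
    obtain rfl : p = p' := by omega
    obtain rfl : q = q' := by omega
    obtain rfl : r = r' := by omega
    obtain rfl : a = a' := by
      have := Nat.eq_of_mul_eq_mul_right hr.pos heq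
      have := Nat.eq_of_mul_eq_mul_right hq.pos this
      exact Nat.eq_of_mul_eq_mul_right hp.pos this
    rfl
  · rintro ⟨a, p, q, r⟩ ht
    obtain ⟨m1, m2, m3, m4⟩ := hmem _ ht
    obtain ⟨ha, hp, hq, hr, -, -, -, -, -, -, -, hrx, -⟩ := hprod a p q r m1 m2 m3 m4
    have hpos : 0 < a * p * q := Nat.mul_pos (Nat.mul_pos ha hp.pos) hq.pos
    have hposR : (0 : ℝ) < a * p * q := by exact_mod_cast hpos
    rw [le_div_iff₀ hposR] at hrx
    refine Finset.mem_Icc.2 ⟨Nat.mul_pos hpos hr.pos, Nat.le_floor ?_⟩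
    push_cast
    linarith
  · rintro ⟨a, p, q, r⟩ ht
    obtain ⟨m1, m2, m3, m4⟩ := hmem _ ht
    obtain ⟨ha, hp, hq, hr, hap, hpq, hqr, hp2, hq2, hq3, hr3, hrx, -⟩ :=
      hprod a p q r m1 m2 m3 m4
    have hrx2 : (r : ℝ) ^ 2 ≤ x :=
      (pow_le_pow_left₀ r.cast_nonneg hrx 2).trans (hlarge a m1 p m2 q m3)
    have hq2x : (q : ℝ) ^ 2 ≤ x := (pow_le_pow_left₀ q.cast_nonneg hq3 2).trans h3x
    have hp2x : (p : ℝ) ^ 2 ≤ x := (pow_le_pow_left₀ p.cast_nonneg (hp2.trans h23) 2).trans h3x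
    have ndvd : ∀ s t : ℕ, s.Prime → 0 < t → t < s → ¬ s ∣ t := fun s t _ h0 hlt hd =>
      absurd (Nat.le_of_dvd h0 hd) (by omega)
    have d1 := ndvd p a hp ha hap
    have d2 : ¬ q ∣ a * p := by
      rw [hq.dvd_mul, not_or]
      exact ⟨ndvd q a hq ha (by omega), ndvd q p hq hp.pos hpq⟩
    have d3 : ¬ r ∣ a * p * q := by
      rw [hr.dvd_mul, hr.dvd_mul, not_or, not_or]
      exact ⟨⟨ndvd r a hr ha (by omega), ndvd r p hr hp.pos (by omega)⟩, ndvd r q hr hq.pos hqr⟩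
    exact (h_mul_prime hp hp2x d1).trans ((h_mul_prime hq hq2x d2).trans (h_mul_prime hr hrx2 d3))

/-- The exponents satisfy three constraints, with `√x = z^20`: `a p q ≥ z^21` gives `r ≤ z^19 ≤ √x`;
`a p q ≤ z^25` lets `r` range up to at least `z^15 ≥ 6 z^12`, as the prime count needs; and `a^4 ≤
z^8 ≤ x`, as needed for `h x a`. -/
theorem sum_h_ge_of_pow {z x Z Y : ℝ} (hx : x = z ^ 40) (hz6 : 6 ≤ z) (hZz : Z ≤ z) (hYz : Y ≤ z)
    (hZ : ∀ z y : ℝ, Z ≤ z → z ≤ y →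
      Real.log z / 32 ≤ ∑ p ∈ primesIoc y (z * y), Real.log p / p)
    (hY : ∀ w y x : ℝ, Y ≤ y → 0 ≤ w → 6 * w ≤ y → y ≤ x → 1 < x →
      y / (4 * Real.log x) ≤ (primesIoc w y).card) :
    (1 / 1280) ^ 2 * (1 / 102400) * x * Real.log x ≤ ∑ n ∈ Finset.Icc 1 ⌊x⌋₊, h x n := by
  have hz1 : 1 < z := by linarith
  have hz0 : 0 < z := by linarith
  have hpow : ∀ {i j : ℕ}, i ≤ j → z ^ i ≤ z ^ j := fun hij => pow_le_pow_right₀ hz1.le hij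
  have hx1 : 1 < x := by rw [hx]; exact one_lt_pow₀ hz1 (by norm_num)
  have hlz : 0 < Real.log z := Real.log_pos hz1
  have hlx : Real.log x = 40 * Real.log z := by rw [hx, Real.log_pow]; norm_num
  have hzpow : ∀ i : ℕ, 1 ≤ i → z ≤ z ^ i := fun i hi => le_self_pow₀ hz1.le (by omega)
  set A := (Finset.Icc 1 (⌊z⌋₊ ^ 2)).filter Squarefree with hA
  have hAz : ∀ a ∈ A, Squarefree a ∧ 0 < a ∧ (a : ℝ) ≤ z ^ 2 := by
    intro a ha
    obtain ⟨ha1, ha2⟩ := Finset.mem_filter.1 ha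
    obtain ⟨ha3, ha4⟩ := Finset.mem_Icc.1 ha1
    refine ⟨ha2, ha3, ?_⟩
    calc (a : ℝ) ≤ (⌊z⌋₊ : ℝ) ^ 2 := by exact_mod_cast ha4
      _ ≤ z ^ 2 := by gcongr; exact Nat.floor_le hz0.le
  have hP : ∀ p ∈ primesIoc (z ^ 10) (z ^ 11), z ^ 10 < p ∧ (p : ℝ) ≤ z ^ 11 := fun p hp =>
    ((mem_primesIoc (by positivity) (by positivity)).1 hp).1
  have hQ : ∀ q ∈ primesIoc (z ^ 11) (z ^ 12), z ^ 11 < q ∧ (q : ℝ) ≤ z ^ 12 := fun q hq =>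
    ((mem_primesIoc (by positivity) (by positivity)).1 hq).1
  have hlow : ∀ a ∈ A, ∀ p ∈ primesIoc (z ^ 10) (z ^ 11), ∀ q ∈ primesIoc (z ^ 11) (z ^ 12),
      z ^ 21 ≤ (a : ℝ) * p * q ∧ (a : ℝ) * p * q ≤ z ^ 25 := by
    intro a ha p hp q hq
    obtain ⟨-, ha0, ha2⟩ := hAz a ha
    have ha1 : (1 : ℝ) ≤ a := by exact_mod_cast ha0
    obtain ⟨hp1, hp2⟩ := hP p hp
    obtain ⟨hq1, hq2⟩ := hQ q hq
    constructor
    · calc z ^ 21 = 1 * z ^ 10 * z ^ 11 := by ring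
        _ ≤ (a : ℝ) * p * q := by gcongr
    · calc (a : ℝ) * p * q ≤ z ^ 2 * z ^ 11 * z ^ 12 := by gcongr
        _ = z ^ 25 := by ring
  have hmain := sum_h_ge (x := x) (y₁ := z ^ 10) (y₂ := z ^ 11) (y₃ := z ^ 12) (A := A)
    (fun a ha => ⟨(hAz a ha).2.1, (hAz a ha).2.2.trans (hpow (by norm_num))⟩) (by positivity)
    (hpow (by norm_num)) (hpow (by norm_num))
    (by rw [hx, ← pow_mul]; exact hpow (by norm_num)) (by
      intro a ha p hp q hq
      have h1 : x / (a * p * q) ≤ z ^ 19 := by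
        have h21 := (hlow a ha p hp q hq).1
        rw [div_le_iff₀ (lt_of_lt_of_le (by positivity) h21), hx]
        calc z ^ 40 = z ^ 19 * z ^ 21 := by ring
          _ ≤ _ := by gcongr
      calc (x / (a * p * q)) ^ 2 ≤ (z ^ 19) ^ 2 :=
            pow_le_pow_left₀ (by positivity) h1 2
        _ ≤ x := by rw [hx, ← pow_mul]; exact hpow (by norm_num))
  refine le_trans ?_ hmain
  have hterm : ∀ a ∈ A, ∀ p ∈ primesIoc (z ^ 10) (z ^ 11), ∀ q ∈ primesIoc (z ^ 11) (z ^ 12),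
      x / (8 * Real.log x) * (((2 : ℝ) ^ a.primeFactors.card * (a : ℝ)⁻¹) * ((p : ℝ)⁻¹ * (q : ℝ)⁻¹))
        ≤ h x a * (primesIoc (z ^ 12) (x / (a * p * q))).card := by
    intro a ha p hp q hq
    obtain ⟨hl, hu⟩ := hlow a ha p hp q hq
    have hpos : (0 : ℝ) < a * p * q := lt_of_lt_of_le (by positivity) hl
    have h15 : z ^ 15 ≤ x / (a * p * q) := by
      rw [le_div_iff₀ hpos, hx]
      calc z ^ 15 * (a * p * q) ≤ z ^ 15 * z ^ 25 := by gcongr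
        _ = z ^ 40 := by ring
    have hcard := hY (z ^ 12) (x / (a * p * q)) x
      (hYz.trans ((hzpow 15 (by norm_num)).trans h15)) (by positivity)
      (le_trans (by
        calc 6 * z ^ 12 ≤ z ^ 3 * z ^ 12 := by
              gcongr; exact hz6.trans (hzpow 3 (by norm_num))
          _ = z ^ 15 := by ring) h15)
      (div_le_self (by linarith) ((one_le_pow₀ hz1.le).trans hl)) hx1
    have hha := two_pow_le_h (x := x) (hAz a ha).1 (by
      calc (a : ℝ) ^ 4 ≤ (z ^ 2) ^ 4 := by gcongr; exact (hAz a ha).2.2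
        _ ≤ x := by rw [hx, ← pow_mul]; exact hpow (by norm_num)) hx1
    have hlx0 : 0 < Real.log x := Real.log_pos hx1
    calc _ = 2 ^ a.primeFactors.card / 2 * (x / (a * p * q) / (4 * Real.log x)) := by
          have ha0 : (a : ℝ) ≠ 0 := by rintro h0; simp [h0] at hpos
          have hp0 : (p : ℝ) ≠ 0 := by rintro h0; simp [h0] at hpos
          have hq0 : (q : ℝ) ≠ 0 := by rintro h0; simp [h0] at hpos
          field_simp
          norm_num
      _ ≤ _ := by
          refine mul_le_mul hha hcard (by positivity) (h_nonneg x a)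
  have hS := log_sq_le_sum_squarefree hz1.le
  rw [← hA] at hS
  have e11 : z ^ 11 = z * z ^ 10 := by ring
  have e12 : z ^ 12 = z * z ^ 11 := by ring
  have hSp := sum_inv_primesIoc_ge hz1 (y := z ^ 10) (by positivity) hx1
    (by rw [← e11, hx]; exact hpow (by norm_num)) (hZ z _ hZz (hzpow 10 (by norm_num)))
  have hSq := sum_inv_primesIoc_ge hz1 (y := z ^ 11) (by positivity) hx1
    (by rw [← e12, hx]; exact hpow (by norm_num)) (hZ z _ hZz (hzpow 11 (by norm_num)))
  rw [← e11] at hSp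
  rw [← e12] at hSq
  -- `1280 = 32 · 40`: the interval `(y, z y]` carries a fixed share of `∑ 1/p` because `log x = 40
  -- log z`.
  have hratio : Real.log z / (32 * Real.log x) = 1 / 1280 := by
    rw [hlx]; field_simp; norm_num
  rw [hratio] at hSp hSq
  have hle := Finset.sum_le_sum fun a ha => Finset.sum_le_sum fun p hp =>
    Finset.sum_le_sum fun q hq => hterm a ha p hp q hq
  refine le_trans ?_ hle
  simp only [← Finset.mul_sum, ← Finset.sum_mul]
  have hlx0 : 0 < Real.log x := Real.log_pos hx1
  -- `102400 = 8 · 8 · 40²`: one `8` from the weight and the count of `r`, one from the sum over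
  -- `a`, and `40²` from `(log z)²`.
  calc (1 / 1280) ^ 2 * (1 / 102400) * x * Real.log x
      = x / (8 * Real.log x) * (Real.log z ^ 2 / 8 * (1 / 1280 * (1 / 1280))) := by
        rw [hlx]; field_simp; norm_num
    _ ≤ _ := by
        gcongr
        linarith

end HeckeLowerBound

theorem mainTheorem2 :
    ∃ c₀ : ℝ, 0 < c₀ ∧ ∃ x₀ : ℝ, 2 ≤ x₀ ∧ ∀ x : ℝ, x₀ ≤ x →
      c₀ * x * Real.log x ≤ ∑ n ∈ Finset.Icc 1 ⌊x⌋₊, HeckeLowerBound.h x n := by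
  obtain ⟨Z, hZ1, hZ⟩ := HeckeLowerBound.exists_sum_log_div_primesIoc_ge
  obtain ⟨Y, hY1, hY⟩ := HeckeLowerBound.exists_card_primesIoc_ge
  set M := max 6 (max Z Y) with hM
  have hM6 : 6 ≤ M := le_max_left _ _
  -- The threshold `M ^ 40` ensures `z = x ^ (1/40) ≥ M`.
  refine ⟨(1 / 1280) ^ 2 * (1 / 102400), by norm_num, M ^ 40, ?_, fun x hx => ?_⟩
  · exact le_trans (by linarith) (le_self_pow₀ (by linarith : (1 : ℝ) ≤ M) (by norm_num))
  have hx0 : 0 ≤ x := le_trans (by positivity) hx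
  have hxz : x = (x ^ ((40 : ℕ) : ℝ)⁻¹) ^ 40 := (Real.rpow_inv_natCast_pow hx0 (by norm_num)).symm
  have hMz : M ≤ x ^ ((40 : ℕ) : ℝ)⁻¹ := by
    rw [hxz] at hx
    exact le_of_pow_le_pow_left₀ (by norm_num) (by positivity) hx
  exact HeckeLowerBound.sum_h_ge_of_pow hxz (hM6.trans hMz)
    (((le_max_left _ _).trans (le_max_right _ _)).trans hMz)
    (((le_max_right _ _).trans (le_max_right _ _)).trans hMz) hZ hY
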